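/- For $X\in M_n(\mathbb C)$ let $S_X : M_n(\mathbb C)\to M_n(\mathbb C)$, $S_X(Y)=X\circ Y$, be the entrywise multiplication $(X\circ Y)_{(i,j)}=X_{(i,j)}Y_{(i,j)}$, and let the Schur multiplier norm $\|S_X\|$ of $X$ be the norm of this linear operator when $M_n(\mathbb C)$ carries the operator norm (of matrices acting on the Hilbert space $\mathbb C^n$). Let $\mathcal Q_n$ be the set of positive semidefinite matrices in $M_n(\mathbb C)$ all of whose diagonal entries are equal to $1$. Then $\mathcal Q_n$ is a face of the unit ball $\{X\in M_n(\mathbb C) : \|S_X\|\le 1\}$ of the Schur multipliers, that is, a convex extreme subset of it. In particular, if $0<\alpha<1$, $X\in\mathcal Q_n$, and $Y,Z\in M_n(\mathbb C)$ satisfy $\|S_Y\|\le 1$, $\|S_Z\|\le 1$ and $X=(1-\alpha)Y+\alpha Z$, then both $Y$ and $Z$ belong to $\mathcal Q_n$. -/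

import Mathlib

open scoped ComplexOrder Matrix Matrix.Norms.L2Operator

/-- The Schur multiplier `S_X : Y ↦ X ∘ Y` (entrywise product), as a linear map on the space of
complex `m × n` matrices. -/
def schurMul {m n : ℕ} (X : Matrix (Fin m) (Fin n) ℂ) :
    Matrix (Fin m) (Fin n) ℂ →ₗ[ℂ] Matrix (Fin m) (Fin n) ℂ where
  toFun Y := X ⊙ Y
  map_add' Y Z := Matrix.hadamard_add X Y Z
  map_smul' c Y := Matrix.hadamard_smul X Y c

/-- The Schur multiplier norm of `X`: the norm of `S_X` as a linear operator on the space of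
`m × n` matrices, which carries the operator norm (from `ℓ²` to `ℓ²`). -/
noncomputable def schurNorm {m n : ℕ} (X : Matrix (Fin m) (Fin n) ℂ) : ℝ :=
  ‖(schurMul X).toContinuousLinearMap‖

/-- The unit ball of the Schur multipliers on `M_n(ℂ)`. -/
def schurBall (n : ℕ) : Set (Matrix (Fin n) (Fin n) ℂ) :=
  {X | schurNorm X ≤ 1}

/-- `𝒬_n`: the positive (semidefinite) complex `n × n` matrices with unit diagonal. -/
def unitDiagPos (n : ℕ) : Set (Matrix (Fin n) (Fin n) ℂ) :=
  {X | X.PosSemidef ∧ ∀ i, X i i = 1}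

/-!
Let `J` be the all-ones matrix, so that `S_X(J) = X`, while `S_X(1) = 1` exactly when `X` has unit
diagonal. A unital contraction `φ` between C⋆-algebras is positive: for self-adjoint `a` and real
`t` one has `‖φ a + i t‖² ≤ ‖a + i t‖² ≤ ‖a‖² + t²`, which is impossible for large `|t|` unless the
imaginary part of `φ a` vanishes, and then `‖‖a‖ - φ a‖ ≤ ‖‖a‖ - a‖ ≤ ‖a‖` for `0 ≤ a` gives
`0 ≤ φ a`. Hence a contractive Schur multiplier with unit diagonal is positive, being the image of
`J ≥ 0`. Conversely `‖A‖ ≤ 1` means that the block matrix `[[1, A], [Aᴴ, 1]]` is positive, and the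
Schur product with the positive matrix `[[X, X], [X, X]]` preserves this when `X ∈ 𝒬_n`.

So `𝒬_n` is cut out of the unit ball by the equations `X i i = 1`. The diagonal entries of matrices
in the ball lie in the closed unit disc, of which `1` is an extreme point, so `𝒬_n` is a face.
-/

section CStarAlgebra

open Complex
open scoped ComplexStarModule

theorem norm_add_I_smul_sq_le {A : Type*} [NonUnitalCStarAlgebra A] {a b : A}
    (ha : IsSelfAdjoint a) (hb : IsSelfAdjoint b) (hab : Commute a b) :
    ‖a + I • b‖ ^ 2 ≤ ‖a‖ ^ 2 + ‖b‖ ^ 2 := by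
  have h_star_mul : star (a + I • b) * (a + I • b) = a * a + b * b := by
    have h_star : star (a + I • b) = a - I • b := by
      rw [star_add, star_smul, ha.star_eq, hb.star_eq, Complex.star_def, conj_I, neg_smul,
        sub_eq_add_neg]
    rw [h_star, ← (hab.smul_right I).mul_self_sub_mul_self_eq', smul_mul_smul_comm, I_mul_I,
      neg_one_smul, sub_neg_eq_add]
  calc ‖a + I • b‖ ^ 2 = ‖a * a + b * b‖ := by
        rw [sq, ← CStarRing.norm_star_mul_self, h_star_mul]
    _ ≤ ‖a * a‖ + ‖b * b‖ := norm_add_le _ _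
    _ = ‖a‖ ^ 2 + ‖b‖ ^ 2 := by rw [ha.norm_mul_self, hb.norm_mul_self]

variable {A B : Type*} [CStarAlgebra A] [CStarAlgebra B]

theorem isSelfAdjoint_of_norm_add_I_smul_algebraMap_sq_le {a : A} {C : ℝ}
    (h : ∀ t : ℝ, ‖a + I • algebraMap ℝ A t‖ ^ 2 ≤ C + t ^ 2) : IsSelfAdjoint a := by
  obtain _ | _ := subsingleton_or_nontrivial A
  · exact Subsingleton.elim _ _
  rw [← imaginaryPart_eq_zero_iff, Subtype.ext_iff]
  refine CFC.eq_zero_of_spectrum_subset_zero (R := ℝ) _ (fun r hr ↦ ?_) (ℑ a).2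
  have h_abs_le (t : ℝ) : |r + t| ≤ ‖a + I • algebraMap ℝ A t‖ := by
    have h_im : (ℑ (a + I • algebraMap ℝ A t) : A) = algebraMap ℝ A t + ℑ a := by
      rw [map_add, imaginaryPart_I_smul, AddSubgroup.coe_add,
        (IsSelfAdjoint.algebraMap A (.all t)).coe_realPart, add_comm]
    calc |r + t| ≤ ‖algebraMap ℝ A t + ℑ a‖ :=
          spectrum.norm_le_norm_of_mem (spectrum.add_mem_add_iff.2 hr)
      _ ≤ ‖a + I • algebraMap ℝ A t‖ := by
        rw [← h_im]
        exact imaginaryPart.norm_le (a + I • algebraMap ℝ A t)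
  have h_linear (t : ℝ) : r ^ 2 + 2 * r * t ≤ C := by
    linarith [h t, sq_le_sq' (neg_le_of_abs_le (h_abs_le t)) (le_of_abs_le (h_abs_le t))]
  by_contra hr0
  replace hr0 : r ≠ 0 := hr0
  have h_large := h_linear ((C + 1) / (2 * r))
  rw [mul_div_cancel₀ (C + 1) (mul_ne_zero two_ne_zero hr0)] at h_large
  linarith [sq_nonneg r]

theorem nonneg_iff_norm_algebraMap_sub_le [PartialOrder A] [StarOrderedRing A] {a : A}
    (ha : IsSelfAdjoint a) {t : ℝ} (ht : ‖a‖ ≤ t) : 0 ≤ a ↔ ‖algebraMap ℝ A t - a‖ ≤ t := by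
  have h_le : a ≤ algebraMap ℝ A t := ha.le_algebraMap_norm_self.trans (algebraMap_mono A ht)
  rw [CStarAlgebra.norm_le_iff_le_algebraMap _ ((norm_nonneg a).trans ht) (sub_nonneg.2 h_le),
    sub_le_self_iff]

theorem map_nonneg_of_contractive_of_map_one [PartialOrder A] [StarOrderedRing A]
    [PartialOrder B] [StarOrderedRing B] {φ : A →ₗ[ℂ] B} (hφ : ∀ a, ‖φ a‖ ≤ ‖a‖)
    (hφ1 : φ 1 = 1) {a : A} (ha : 0 ≤ a) : 0 ≤ φ a := by
  obtain _ | _ := subsingleton_or_nontrivial A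
  · rw [Subsingleton.elim a 0, map_zero]
  have ha_sa : IsSelfAdjoint a := .of_nonneg ha
  have h_scalar (t : ℝ) : φ (algebraMap ℝ A t) = algebraMap ℝ B t := by
    rw [Algebra.algebraMap_eq_smul_one, φ.map_smul_of_tower, hφ1, Algebra.algebraMap_eq_smul_one]
  have h_selfAdjoint : IsSelfAdjoint (φ a) := by
    refine isSelfAdjoint_of_norm_add_I_smul_algebraMap_sq_le (C := ‖a‖ ^ 2) fun t ↦ ?_
    calc ‖φ a + I • algebraMap ℝ B t‖ ^ 2 = ‖φ (a + I • algebraMap ℝ A t)‖ ^ 2 := by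
          rw [map_add, map_smul, h_scalar]
      _ ≤ ‖a + I • algebraMap ℝ A t‖ ^ 2 := by gcongr; exact hφ _
      _ ≤ ‖a‖ ^ 2 + ‖algebraMap ℝ A t‖ ^ 2 :=
          norm_add_I_smul_sq_le ha_sa (.algebraMap A (.all t))
            (Algebra.commute_algebraMap_right t a)
      _ = ‖a‖ ^ 2 + t ^ 2 := by rw [norm_algebraMap', Real.norm_eq_abs, sq_abs]
  rw [nonneg_iff_norm_algebraMap_sub_le h_selfAdjoint (hφ a)]
  calc ‖algebraMap ℝ B ‖a‖ - φ a‖ = ‖φ (algebraMap ℝ A ‖a‖ - a)‖ := by rw [map_sub, h_scalar]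
    _ ≤ ‖algebraMap ℝ A ‖a‖ - a‖ := hφ _
    _ ≤ ‖a‖ := (nonneg_iff_norm_algebraMap_sub_le ha_sa le_rfl).1 ha

end CStarAlgebra

section Matrix

open Matrix
open scoped MatrixOrder

variable {𝕜 m n : Type*} [RCLike 𝕜] [Fintype m] [Fintype n] [DecidableEq n]

theorem l2_opNorm_single [DecidableEq m] (i : m) (j : n) (c : 𝕜) : ‖single i j c‖ = ‖c‖ := by
  rw [← mul_self_inj (norm_nonneg _) (norm_nonneg _), ← l2_opNorm_conjTranspose_mul_self,
    conjTranspose_single, single_mul_single_same, ← diagonal_single, l2_opNorm_diagonal,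
    Pi.norm_single, norm_mul, norm_star]

theorem l2_opNorm_le_one_iff_posSemidef_fromBlocks [DecidableEq m] (A : Matrix m n ℂ) :
    ‖A‖ ≤ 1 ↔ (fromBlocks 1 A Aᴴ 1).PosSemidef := by
  let : Invertible (1 : Matrix m m ℂ) := invertibleOne
  rw [PosDef.fromBlocks₁₁ A 1 PosDef.one, inv_one, Matrix.mul_one, ← le_iff,
    ← CStarAlgebra.norm_le_one_iff_of_nonneg _ (posSemidef_conjTranspose_mul_self A).nonneg,
    l2_opNorm_conjTranspose_mul_self, ← sq, sq_le_one_iff₀ (norm_nonneg A)]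

theorem l2_opNorm_hadamard_le_one_of_posSemidef_fromBlocks {P : Matrix m m ℂ} {X : Matrix m n ℂ}
    {Q : Matrix n n ℂ} (h : (fromBlocks P X Xᴴ Q).PosSemidef) (hP : ∀ i, P i i ≤ 1)
    (hQ : ∀ j, Q j j ≤ 1) {A : Matrix m n ℂ} (hA : ‖A‖ ≤ 1) : ‖X ⊙ A‖ ≤ 1 := by
  classical
  rw [l2_opNorm_le_one_iff_posSemidef_fromBlocks] at hA ⊢
  have h_slack : (diagonal (Sum.elim (1 - P.diag) (1 - Q.diag))).PosSemidef :=
    .diagonal (by rintro (i | j) <;> simp [hP, hQ])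
  have h_blocks : fromBlocks P X Xᴴ Q ⊙ fromBlocks 1 A Aᴴ 1 +
      diagonal (Sum.elim (1 - P.diag) (1 - Q.diag)) = fromBlocks 1 (X ⊙ A) (X ⊙ A)ᴴ 1 := by
    ext (i | i) (j | j)
    · by_cases hij : i = j <;> simp [one_apply, hij]
    · simp
    · simp
    · by_cases hij : i = j <;> simp [one_apply, hij]
  exact h_blocks ▸ (h.hadamard hA).add h_slack

end Matrix

section SchurMultiplier

open Matrix

theorem norm_hadamard_le_schurNorm_mul {m n : ℕ} (X A : Matrix (Fin m) (Fin n) ℂ) :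
    ‖X ⊙ A‖ ≤ schurNorm X * ‖A‖ :=
  (schurMul X).toContinuousLinearMap.le_opNorm A

theorem norm_apply_le_schurNorm {m n : ℕ} (X : Matrix (Fin m) (Fin n) ℂ) (i : Fin m)
    (j : Fin n) : ‖X i j‖ ≤ schurNorm X := by
  have h_hadamard : X ⊙ single i j 1 = single i j (X i j) := by
    ext k l
    by_cases hkl : i = k ∧ j = l
    · obtain ⟨rfl, rfl⟩ := hkl
      simp
    · simp [single_apply_of_ne, hkl]
  calc ‖X i j‖ = ‖X ⊙ single i j 1‖ := by rw [h_hadamard, l2_opNorm_single]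
    _ ≤ schurNorm X * ‖single i j (1 : ℂ)‖ := norm_hadamard_le_schurNorm_mul X _
    _ = schurNorm X := by rw [l2_opNorm_single, norm_one, mul_one]

theorem schurNorm_le_one_of_posSemidef_fromBlocks {m n : ℕ} {P : Matrix (Fin m) (Fin m) ℂ}
    {X : Matrix (Fin m) (Fin n) ℂ} {Q : Matrix (Fin n) (Fin n) ℂ}
    (h : (fromBlocks P X Xᴴ Q).PosSemidef) (hP : ∀ i, P i i ≤ 1) (hQ : ∀ j, Q j j ≤ 1) :
    schurNorm X ≤ 1 :=
  ContinuousLinearMap.opNorm_le_of_unit_norm zero_le_one fun _ hA ↦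
    l2_opNorm_hadamard_le_one_of_posSemidef_fromBlocks h hP hQ hA.le

variable {n : ℕ} {X : Matrix (Fin n) (Fin n) ℂ}

theorem schurNorm_le_one_of_posSemidef (hX : X.PosSemidef) (hd : ∀ i, X i i ≤ 1) :
    schurNorm X ≤ 1 := by
  have h_blocks : X.submatrix (Sum.elim id id) (Sum.elim id id) = fromBlocks X X Xᴴ X := by
    rw [hX.isHermitian.eq]
    ext (i | i) (j | j) <;> rfl
  exact schurNorm_le_one_of_posSemidef_fromBlocks (h_blocks ▸ hX.submatrix _) hd hd

open scoped MatrixOrder in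
theorem posSemidef_of_schurNorm_le_one (hX : schurNorm X ≤ 1) (hd : ∀ i, X i i = 1) :
    X.PosSemidef := by
  have h_contractive (A : Matrix (Fin n) (Fin n) ℂ) : ‖schurMul X A‖ ≤ ‖A‖ :=
    (norm_hadamard_le_schurNorm_mul X A).trans (mul_le_of_le_one_left (norm_nonneg A) hX)
  have h_unital : schurMul X 1 = 1 := hadamard_one_eq_one_iff.2 (funext hd)
  have h_ones : (0 : Matrix (Fin n) (Fin n) ℂ) ≤ of 1 := by
    have h_vecMulVec : vecMulVec 1 (star 1) = (of 1 : Matrix (Fin n) (Fin n) ℂ) := by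
      ext i j
      simp [vecMulVec_apply]
    rw [nonneg_iff_posSemidef, ← h_vecMulVec]
    exact posSemidef_vecMulVec_self_star 1
  have h := map_nonneg_of_contractive_of_map_one h_contractive h_unital h_ones
  rwa [nonneg_iff_posSemidef, schurMul, LinearMap.coe_mk, AddHom.coe_mk,
    hadamard_of_one] at h

theorem unitDiagPos_eq_setOf_mem_schurBall (n : ℕ) :
    unitDiagPos n = {X ∈ schurBall n | ∀ i, X i i = 1} :=
  Set.ext fun _ ↦ and_congr_left fun hd ↦
    ⟨fun hX ↦ schurNorm_le_one_of_posSemidef hX fun i ↦ (hd i).le,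
      fun hX ↦ posSemidef_of_schurNorm_le_one hX hd⟩

theorem convex_unitDiagPos (n : ℕ) : Convex ℝ (unitDiagPos n) := by
  rintro X ⟨hX, hXd⟩ Y ⟨hY, hYd⟩ a b ha hb hab
  refine ⟨(hX.smul ha).add (hY.smul hb), fun i ↦ ?_⟩
  simp [hXd, hYd, ← Complex.ofReal_add, hab]

theorem isExtreme_schurBall_unitDiagPos (n : ℕ) : IsExtreme ℝ (schurBall n) (unitDiagPos n) := by
  rw [unitDiagPos_eq_setOf_mem_schurBall]
  refine ⟨Set.sep_subset _ _, ?_⟩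
  rintro Y hY Z hZ _ ⟨_, hd⟩ ⟨a, b, ha, hb, hab, rfl⟩
  refine ⟨hY, fun i ↦ ?_⟩
  have h_one : (1 : ℂ) ∈ (Metric.closedBall 0 1).extremePoints ℝ :=
    StrictConvexSpace.sphere_subset_extremePoints_closedBall 0 one_ne_zero (by simp)
  have h_mem {W : Matrix (Fin n) (Fin n) ℂ} (hW : W ∈ schurBall n) :
      W i i ∈ Metric.closedBall (0 : ℂ) 1 :=
    mem_closedBall_zero_iff.2 ((norm_apply_le_schurNorm W i i).trans hW)
  exact h_one.2 (h_mem hY) (h_mem hZ) ⟨a, b, ha, hb, hab, hd i⟩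

end SchurMultiplier

theorem mainTheorem4 (n : ℕ) :
    (Convex ℝ (unitDiagPos n) ∧ IsExtreme ℝ (schurBall n) (unitDiagPos n)) ∧
      ∀ (α : ℝ) (X Y Z : Matrix (Fin n) (Fin n) ℂ), 0 < α → α < 1 →
        X ∈ unitDiagPos n → schurNorm Y ≤ 1 → schurNorm Z ≤ 1 →
        X = (1 - α) • Y + α • Z →
        Y ∈ unitDiagPos n ∧ Z ∈ unitDiagPos n := by
  have hface := isExtreme_schurBall_unitDiagPos n
  refine ⟨⟨convex_unitDiagPos n, hface⟩, fun α X Y Z hα₀ hα₁ hX hY hZ hXYZ ↦ ?_⟩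
  have hseg : X ∈ openSegment ℝ Y Z :=
    ⟨1 - α, α, sub_pos.2 hα₁, hα₀, sub_add_cancel 1 α, hXYZ.symm⟩
  exact ⟨hface.left_mem_of_mem_openSegment hY hZ hX hseg,
    hface.right_mem_of_mem_openSegment hY hZ hX hseg⟩
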